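/- A simple $\mathrm{TS}(v,\lambda)$ (simple $\lambda$-fold triple system of order $v$) is a pair $\mathscr{D}=(V,\mathcal{B})$ in which $V$ is a set of $v$ points and $\mathcal{B}$ is a collection, without repetitions, of $3$-subsets of $V$ (blocks), such that each pair of distinct points of $V$ is contained in exactly $\lambda$ blocks. Its block intersection graph $\Gamma_{\mathscr{D}}$ has vertex set $\mathcal{B}$, two distinct blocks being adjacent if and only if they have non-empty intersection. A finite graph is $n$-existentially closed, where $n$ is at most its number of vertices, if for all disjoint sets $A$, $B$ of vertices with $|A\cup B|=n$ (one of $A$, $B$ may be empty) there is a vertex $z\notin A\cup B$ adjacent to every vertex of $A$ and to no vertex of $B$. The existential closure number $\Xi(\Gamma)$ of a finite graph $\Gamma$ is the largest $n$ such that $\Gamma$ is $n$-existentially closed, and $0$ if $\Gamma$ is not $1$-existentially closed. Let $\mathscr{D}$ be a simple $\mathrm{TS}(9,\lambda)$ with $2\le\lambda\le 6$. Then $\Xi(\Gamma_{\mathscr{D}})=1$. -/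

import Mathlib

/-- `G` is `n`-existentially closed: for any disjoint sets of vertices `A`, `B` with
`|A ∪ B| = n` there is a vertex outside `A ∪ B` adjacent to every vertex of `A` and to no vertex
of `B`. The condition `n ≤ |W|` excludes the orders for which there are no such `A`, `B`. -/
def SimpleGraph.IsExistentiallyClosed {W : Type*} (G : SimpleGraph W) (n : ℕ) : Prop :=
  (n : ℕ∞) ≤ ENat.card W ∧
    ∀ A B : Set W, Disjoint A B → (A ∪ B).encard = n →
      ∃ z : W, z ∉ A ∪ B ∧ (∀ a ∈ A, G.Adj z a) ∧ (∀ b ∈ B, ¬ G.Adj z b)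

theorem SimpleGraph.bddAbove_isExistentiallyClosed {W : Type*} [Finite W] (G : SimpleGraph W) :
    BddAbove {n : ℕ | G.IsExistentiallyClosed n} := by
  refine ⟨Nat.card W, fun n hn => ?_⟩
  have h := hn.1
  rw [ENat.card_eq_coe_natCard] at h
  exact_mod_cast h

/-- The existential closure number of a finite graph: the largest `n` such that `G` is
`n`-existentially closed, and `0` if `G` is not `1`-existentially closed. The set below is
bounded, by the previous lemma, and `sSup ∅ = 0`. -/
noncomputable def SimpleGraph.existentialClosureNumber {W : Type*} [Finite W]
    (G : SimpleGraph W) : ℕ :=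
  sSup {n : ℕ | G.IsExistentiallyClosed n}

/-- A set system on the point set `V`: a finite collection of subsets of `V`, called blocks, in
which repetitions are allowed. -/
structure SetSystem (V : Type*) where
  blocks : Multiset (Finset V)

namespace SetSystem

/-- No block is repeated. -/
def IsSimple {V : Type*} (D : SetSystem V) : Prop := D.blocks.Nodup

/-- `D` is a `t`-`(v, k, l)` design. -/
structure IsDesign {V : Type*} [Fintype V] [DecidableEq V] (D : SetSystem V)
    (t v k l : ℕ) : Prop where
  card_points : Fintype.card V = v
  card_block : ∀ B ∈ D.blocks, B.card = k
  card_blocks_containing : ∀ T : Finset V, T.card = t →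
    Multiset.card (D.blocks.filter (fun B => T ⊆ B)) = l

/-- A `TS(v, l)`: an `l`-fold triple system of order `v`. -/
def IsTripleSystem {V : Type*} [Fintype V] [DecidableEq V] (D : SetSystem V)
    (v l : ℕ) : Prop :=
  D.IsDesign 2 v 3 l

/-- The block intersection graph. Its vertices are the blocks, a block of multiplicity `m`
giving `m` vertices; two distinct vertices are adjacent if the blocks have a common point. -/
def blockIntersectionGraph {V : Type*} [DecidableEq V] (D : SetSystem V) :
    SimpleGraph D.blocks.ToType where
  Adj B₁ B₂ := B₁ ≠ B₂ ∧ (B₁.1 ∩ B₂.1).Nonempty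
  symm := ⟨fun _ _ h => ⟨h.1.symm, by rw [Finset.inter_comm]; exact h.2⟩⟩
  loopless := ⟨fun _ h => h.1 rfl⟩

end SetSystem

/-!
The block intersection graph is `1`-existentially closed by elementary counting, and existential
closure of order `n + 1` implies that of order `n`, so it is enough to refute order `2`. Only one
consequence of order `2` is used, `HasCommonDisjointBlock`: any two distinct blocks are disjoint
from a common third block.

On nine points this forces the complement of the union of two disjoint blocks to be a block
(`compl_sdiff_mem`). A triple is disjoint from `3l` blocks, or `3l - 1` if it is itself a block
(`card_disjoint_add`). The two facts together bound `l`: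

* if `T` is not a block, no two blocks split the complement of `T`, which has ten splittings
  into two triples, so `3l ≤ 10` (`le_three`);
* if `X` is a block, the blocks disjoint from it come in complementary pairs, so `3l - 1` is
  even (`two_mul_card_disjoint_mem`).

Hence `l = 3`, and for a fixed block `X` there are eight blocks in the six-point set `Xᶜ`, four
through each point. Every pair in `Xᶜ` lies in at least one of the eight
(`exists_disjoint_of_pair`) and at most two (`card_disjoint_pair_le_two`), while the three pairs
of each of the eight blocks lie in six of them in total, with multiplicity
(`sum_card_disjoint_pair`). So every pair in `Xᶜ` lies in exactly two, which would make
`2 * 15 / 3 = 10` blocks in `Xᶜ` instead of eight (`false_of_three`).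
-/

/-! ### Double counting -/

open Finset in
/-- Both sides count the pairs `(B, e)` with `B ∈ 𝓕` and `e` a 2-subset of `B ∩ T`. -/
theorem Finset.sum_choose_two_card_inter {V : Type*} [DecidableEq V] (𝓕 : Finset (Finset V))
    (T : Finset V) :
    ∑ B ∈ 𝓕, (#(B ∩ T)).choose 2 = ∑ e ∈ T.powersetCard 2, #{B ∈ 𝓕 | e ⊆ B} := by
  have h := sum_card_bipartiteAbove_eq_sum_card_bipartiteBelow (s := 𝓕) (t := T.powersetCard 2)
    (fun B e => e ⊆ B)
  simp only [bipartiteAbove, bipartiteBelow] at h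
  rw [← h]
  refine sum_congr rfl fun B _ => ?_
  rw [← card_powersetCard]
  congr 1
  ext e
  simp only [mem_powersetCard, mem_filter, subset_inter_iff]
  tauto

open Finset in
/-- With `i = #(B ∩ T)`, this is `C(i, 2) + C(3 - i, 2) = 1 + 2 [i = 0] + 2 [i = 3]`. -/
theorem Finset.choose_two_card_inter_add_sdiff {V : Type*} [DecidableEq V] {B T : Finset V}
    (hB : #B = 3) (hT : #T = 3) :
    (#(B ∩ T)).choose 2 + (#(B \ T)).choose 2 =
      1 + 2 * (if Disjoint B T then 1 else 0) + 2 * (if T = B then 1 else 0) := by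
  have hs : #(B ∩ T) + #(B \ T) = 3 := by rw [card_inter_add_card_sdiff, hB]
  have hd : Disjoint B T ↔ #(B ∩ T) = 0 := by
    rw [card_eq_zero, disjoint_iff_inter_eq_empty]
  have he : T = B ↔ #(B ∩ T) = 3 := by
    refine ⟨by rintro rfl; simpa using hT, fun hc => ?_⟩
    rw [← eq_of_subset_of_card_le inter_subset_left (hB.trans hc.symm).le]
    exact (eq_of_subset_of_card_le inter_subset_right (hT.trans hc.symm).le).symm
  simp only [hd, he]
  have hi : #(B ∩ T) ≤ 3 := by omega
  have hj : #(B \ T) = 3 - #(B ∩ T) := by omega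
  rw [hj]
  generalize #(B ∩ T) = i at hi
  interval_cases i <;> rfl

/-- `𝓑` is the block set of a simple `TS(9, l)` on `V`. -/
structure IsSimpleTripleSystemNine {V : Type*} [Fintype V] [DecidableEq V]
    (𝓑 : Finset (Finset V)) (l : ℕ) : Prop where
  card_points : Fintype.card V = 9
  card_block : ∀ B ∈ 𝓑, B.card = 3
  card_blocks_containing : ∀ e : Finset V, e.card = 2 → (𝓑.filter (e ⊆ ·)).card = l

namespace IsSimpleTripleSystemNine

open Finset

variable {V : Type*} [Fintype V] [DecidableEq V] {𝓑 : Finset (Finset V)} {l : ℕ}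

theorem sum_choose_two (h : IsSimpleTripleSystemNine 𝓑 l) (T : Finset V) :
    ∑ B ∈ 𝓑, (#(B ∩ T)).choose 2 = (#T).choose 2 * l := by
  rw [sum_choose_two_card_inter, sum_congr rfl fun e he =>
    h.card_blocks_containing e (mem_powersetCard.1 he).2]
  simp

theorem card_eq (h : IsSimpleTripleSystemNine 𝓑 l) : #𝓑 = 12 * l := by
  have h1 := h.sum_choose_two univ
  rw [sum_congr rfl fun B hB => by rw [inter_univ, h.card_block B hB], card_univ,
    h.card_points] at h1
  norm_num [Nat.choose] at h1
  omega

theorem card_compl (h : IsSimpleTripleSystemNine 𝓑 l) {T : Finset V} (hT : #T = 3) :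
    #Tᶜ = 6 := by
  rw [Finset.card_compl, h.card_points, hT]

theorem card_compl_sdiff (h : IsSimpleTripleSystemNine 𝓑 l) {T B : Finset V} (hT : #T = 3)
    (hB : #B = 3) (hd : Disjoint B T) : #(Tᶜ \ B) = 3 := by
  rw [card_sdiff_of_subset (subset_compl_iff_disjoint_right.2 hd), h.card_compl hT, hB]

/-- A triple `T` that is not a block is disjoint from `3l` blocks, a block from `3l - 1`. -/
theorem card_disjoint_add (h : IsSimpleTripleSystemNine 𝓑 l) {T : Finset V} (hT : #T = 3) :
    #{B ∈ 𝓑 | Disjoint B T} + (if T ∈ 𝓑 then 1 else 0) = 3 * l := by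
  have h1 := h.sum_choose_two T
  have h2 := h.sum_choose_two Tᶜ
  rw [hT] at h1
  rw [h.card_compl hT] at h2
  have h3 := sum_congr (rfl : 𝓑 = 𝓑) fun B hB =>
    choose_two_card_inter_add_sdiff (h.card_block B hB) hT
  simp only [sdiff_eq_inter_compl] at h3
  rw [sum_add_distrib, h1, h2, sum_add_distrib, sum_add_distrib, ← mul_sum, ← mul_sum,
    sum_ite_eq, ← card_filter, sum_const, h.card_eq] at h3
  norm_num [Nat.choose] at h3
  split_ifs at h3 ⊢ <;> omega

/-! ### Parallel classes -/

/-- Any two distinct blocks are disjoint from a common third one. In terms of the block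
intersection graph: any two vertices have a common non-neighbour. -/
def HasCommonDisjointBlock (𝓑 : Finset (Finset V)) : Prop :=
  ∀ X ∈ 𝓑, ∀ Y ∈ 𝓑, X ≠ Y → ∃ Z ∈ 𝓑, Disjoint Z X ∧ Disjoint Z Y

/-- Two disjoint blocks leave only three points, so these form a block. -/
theorem compl_sdiff_mem (h : IsSimpleTripleSystemNine 𝓑 l) (H : HasCommonDisjointBlock 𝓑)
    {X Y : Finset V} (hX : X ∈ 𝓑) (hY : Y ∈ 𝓑) (hd : Disjoint Y X) : Xᶜ \ Y ∈ 𝓑 := by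
  have hne : X ≠ Y := by
    rintro rfl
    have h3 := h.card_block X hX
    rw [disjoint_self_iff_empty] at hd
    simp [hd] at h3
  obtain ⟨Z, hZ, hZX, hZY⟩ := H X hX Y hY hne
  have hsub : Z ⊆ Xᶜ \ Y := subset_sdiff.2 ⟨subset_compl_iff_disjoint_right.2 hZX, hZY⟩
  have hc := h.card_compl_sdiff (h.card_block X hX) (h.card_block Y hY) hd
  rwa [← eq_of_subset_of_card_le hsub (hc.trans (h.card_block Z hZ).symm).le]

/-- If `T` is not a block, then no two blocks split the complement of `T`, so at most half of
the 20 triples in this complement are blocks. -/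
theorem card_disjoint_le_of_notMem (h : IsSimpleTripleSystemNine 𝓑 l)
    (H : HasCommonDisjointBlock 𝓑) {T : Finset V} (hT : #T = 3) (hT' : T ∉ 𝓑) :
    #{B ∈ 𝓑 | Disjoint B T} ≤ 10 := by
  set D : Finset (Finset V) := {B ∈ 𝓑 | Disjoint B T} with hD
  have hmem : ∀ B ∈ D, B ∈ 𝓑 ∧ B ⊆ Tᶜ := fun B hB =>
    ⟨(mem_filter.1 hB).1, subset_compl_iff_disjoint_right.2 (mem_filter.1 hB).2⟩
  have hinj : Set.InjOn (Tᶜ \ ·) (D : Set (Finset V)) := fun B hB C hC hBC => by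
    rw [← Finset.sdiff_sdiff_eq_self (hmem B hB).2, ← Finset.sdiff_sdiff_eq_self (hmem C hC).2]
    exact congrArg (Tᶜ \ ·) hBC
  have hdisj : Disjoint D (D.image (Tᶜ \ ·)) := by
    refine disjoint_right.2 fun C hC hCD => hT' ?_
    obtain ⟨B, hB, rfl⟩ := mem_image.1 hC
    have := h.compl_sdiff_mem H (hmem B hB).1 (hmem _ hCD).1 sdiff_disjoint
    convert this using 1
    have hBT := (hmem B hB).2
    ext x
    have := @hBT x
    simp only [mem_compl, mem_sdiff] at this ⊢
    tauto
  have hsub : D ∪ D.image (Tᶜ \ ·) ⊆ Tᶜ.powersetCard 3 := by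
    refine union_subset (fun B hB => ?_) fun C hC => ?_
    · exact mem_powersetCard.2 ⟨(hmem B hB).2, h.card_block B (hmem B hB).1⟩
    · obtain ⟨B, hB, rfl⟩ := mem_image.1 hC
      exact mem_powersetCard.2 ⟨sdiff_subset,
        h.card_compl_sdiff hT (h.card_block B (hmem B hB).1) (mem_filter.1 hB).2⟩
  have hle := card_le_card hsub
  rw [card_union_of_disjoint hdisj, card_image_of_injOn hinj, card_powersetCard,
    h.card_compl hT] at hle
  norm_num [Nat.choose] at hle
  omega

theorem le_three (h : IsSimpleTripleSystemNine 𝓑 l) (H : HasCommonDisjointBlock 𝓑)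
    (hl : l ≤ 6) : l ≤ 3 := by
  obtain ⟨T, hT, hT'⟩ : ∃ T ∈ (univ : Finset V).powersetCard 3, T ∉ 𝓑 := by
    refine exists_mem_notMem_of_card_lt_card ?_
    rw [h.card_eq, card_powersetCard, card_univ, h.card_points]
    norm_num [Nat.choose]
    omega
  have h3 := (mem_powersetCard.1 hT).2
  have h1 := h.card_disjoint_add h3
  have h2 := h.card_disjoint_le_of_notMem H h3 hT'
  rw [if_neg hT'] at h1
  omega

/-- The blocks disjoint from a block `X` come in pairs splitting `Xᶜ`, and exactly one block of
each pair contains `p`. -/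
theorem two_mul_card_disjoint_mem (h : IsSimpleTripleSystemNine 𝓑 l)
    (H : HasCommonDisjointBlock 𝓑) {X : Finset V} (hX : X ∈ 𝓑) {p : V} (hp : p ∉ X) :
    2 * #{B ∈ 𝓑 | Disjoint B X ∧ p ∈ B} + 1 = 3 * l := by
  have h1 := h.card_disjoint_add (h.card_block X hX)
  rw [if_pos hX, ← card_filter_add_card_filter_not (p ∈ ·), filter_filter, filter_filter] at h1
  have h2 : #{B ∈ 𝓑 | Disjoint B X ∧ p ∈ B} = #{B ∈ 𝓑 | Disjoint B X ∧ p ∉ B} := by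
    refine card_nbij' (Xᶜ \ ·) (Xᶜ \ ·) ?_ ?_ ?_ ?_
    · intro B hB
      simp only [coe_filter, Set.mem_ofPred_eq] at hB ⊢
      exact ⟨h.compl_sdiff_mem H hX hB.1 hB.2.1,
        subset_compl_iff_disjoint_right.1 sdiff_subset, fun hc => (mem_sdiff.1 hc).2 hB.2.2⟩
    · intro B hB
      simp only [coe_filter, Set.mem_ofPred_eq] at hB ⊢
      exact ⟨h.compl_sdiff_mem H hX hB.1 hB.2.1,
        subset_compl_iff_disjoint_right.1 sdiff_subset,
        mem_sdiff.2 ⟨mem_compl.2 hp, hB.2.2⟩⟩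
    · intro B hB
      exact Finset.sdiff_sdiff_eq_self (subset_compl_iff_disjoint_right.2 (mem_filter.1 hB).2.1)
    · intro B hB
      exact Finset.sdiff_sdiff_eq_self (subset_compl_iff_disjoint_right.2 (mem_filter.1 hB).2.1)
  omega

/-! ### Fold three -/

/-- If a block through the pair `e` meets `X`, then it meets `X` in one point; a block disjoint
from both has its complement in `Xᶜ` through `e`. -/
theorem exists_disjoint_of_pair (h : IsSimpleTripleSystemNine 𝓑 l)
    (H : HasCommonDisjointBlock 𝓑) (hl : 0 < l) {X e : Finset V} (hX : X ∈ 𝓑) (he : #e = 2)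
    (heX : Disjoint e X) : ∃ B ∈ 𝓑, Disjoint B X ∧ e ⊆ B := by
  obtain ⟨B, hB⟩ : ({B ∈ 𝓑 | e ⊆ B} : Finset (Finset V)).Nonempty := by
    rw [← card_pos, h.card_blocks_containing e he]
    exact hl
  rw [mem_filter] at hB
  by_cases hBX : X = B
  · subst hBX
    have := heX.mono_right hB.2
    rw [disjoint_self_iff_empty] at this
    simp [this] at he
  obtain ⟨Z, hZ, hZX, hZB⟩ := H X hX B hB.1 hBX
  exact ⟨Xᶜ \ Z, h.compl_sdiff_mem H hX hZ hZX, subset_compl_iff_disjoint_right.1 sdiff_subset,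
    subset_sdiff.2 ⟨subset_compl_iff_disjoint_right.2 heX, (hZB.mono_right hB.2).symm⟩⟩

/-- Some `w` outside `X` has `{p, q, w}` not a block. Blocks in `Xᶜ` through `p, w` and through
`q, w` give two blocks in `Xᶜ` through `p` that avoid `q`, out of four through `p`. -/
theorem card_disjoint_pair_le_two (h : IsSimpleTripleSystemNine 𝓑 3)
    (H : HasCommonDisjointBlock 𝓑) {X e : Finset V} (hX : X ∈ 𝓑) (he : #e = 2)
    (heX : Disjoint e X) : #{B ∈ 𝓑 | Disjoint B X ∧ e ⊆ B} ≤ 2 := by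
  obtain ⟨p, q, hpq, rfl⟩ := card_eq_two.1 he
  rw [disjoint_insert_left, disjoint_singleton_left] at heX
  obtain ⟨hp, hq⟩ := heX
  obtain ⟨w, hwX, hwp, hwq, hw⟩ : ∃ w, w ∉ X ∧ w ≠ p ∧ w ≠ q ∧ {p, q, w} ∉ 𝓑 := by
    by_contra! hc
    have h4 : #(Xᶜ \ {p, q}) = 4 := by
      rw [card_sdiff_of_subset, h.card_compl (h.card_block X hX), he]
      simp [insert_subset_iff, hp, hq]
    have hle := card_le_card_of_injOn (s := Xᶜ \ {p, q}) (t := {B ∈ 𝓑 | {p, q} ⊆ B})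
      (fun w => {p, q, w}) (fun w hw => ?_) (fun w hw w' hw' hww' => ?_)
    · rw [h4, h.card_blocks_containing _ he] at hle
      omega
    · simp only [coe_sdiff, Set.mem_sdiff, mem_coe, mem_compl, mem_insert, mem_singleton,
        not_or] at hw
      rw [mem_coe, mem_filter]
      refine ⟨hc w hw.1 hw.2.1 hw.2.2, ?_⟩
      simp [insert_subset_iff]
    · simp only [coe_sdiff, Set.mem_sdiff, mem_coe, mem_compl, mem_insert, mem_singleton,
        not_or] at hw hw'
      have : w ∈ ({p, q, w'} : Finset V) := by
        refine (Finset.ext_iff.1 hww' w).1 ?_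
        simp
      simpa [hw.2.1, hw.2.2] using this
  -- A block through `p, q, w` would be the triple `{p, q, w}`.
  have hpqw : ∀ B ∈ 𝓑, w ∈ B → p ∈ B → q ∈ B → False := fun B hB h1 h2 h3 => hw <| by
    have hs : {p, q, w} ⊆ B := by simp [insert_subset_iff, h1, h2, h3]
    have hc : #({p, q, w} : Finset V) = 3 := card_eq_three.2 ⟨p, q, w, hpq, hwp.symm, hwq.symm, rfl⟩
    rwa [eq_of_subset_of_card_le hs ((h.card_block B hB).trans hc.symm).le]
  obtain ⟨B₁, hB₁, hd₁, hs₁⟩ := h.exists_disjoint_of_pair H (by norm_num) hX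
    (card_pair hwp) (by simp [hwX, hp])
  obtain ⟨B₂, hB₂, hd₂, hs₂⟩ := h.exists_disjoint_of_pair H (by norm_num) hX
    (card_pair hwq) (by simp [hwX, hq])
  rw [insert_subset_iff, singleton_subset_iff] at hs₁ hs₂
  have hqB₁ : q ∉ B₁ := hpqw B₁ hB₁ hs₁.1 hs₁.2
  have hpB₂ : p ∉ B₂ := fun hc => hpqw B₂ hB₂ hs₂.1 hc hs₂.2
  have hne : B₁ ≠ Xᶜ \ B₂ := fun hc => (mem_sdiff.1 (hc ▸ hs₁.1)).2 hs₂.1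
  have h4 := h.two_mul_card_disjoint_mem H hX hp
  rw [← card_filter_add_card_filter_not (q ∈ ·), filter_filter, filter_filter] at h4
  have hsub : ({B₁, Xᶜ \ B₂} : Finset (Finset V)) ⊆
      {B ∈ 𝓑 | (Disjoint B X ∧ p ∈ B) ∧ q ∉ B} := by
    rw [insert_subset_iff, singleton_subset_iff, mem_filter, mem_filter]
    exact ⟨⟨hB₁, ⟨hd₁, hs₁.2⟩, hqB₁⟩, h.compl_sdiff_mem H hX hB₂ hd₂,
      ⟨subset_compl_iff_disjoint_right.1 sdiff_subset, mem_sdiff.2 ⟨mem_compl.2 hp, hpB₂⟩⟩,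
      fun hc => (mem_sdiff.1 hc).2 hs₂.2⟩
  have hle := card_le_card hsub
  rw [card_pair hne] at hle
  simp only [insert_subset_iff, singleton_subset_iff]
  simp only [and_assoc] at h4 hle
  omega

/-- The sum over the pairs `e ⊆ B` of the number of blocks in `Xᶜ` through `e` is six: each block
in `Xᶜ` and its complement in `Xᶜ` together contribute one, except `B` and its complement, which
contribute three. -/
theorem sum_card_disjoint_pair (h : IsSimpleTripleSystemNine 𝓑 3)
    (H : HasCommonDisjointBlock 𝓑) {X B : Finset V} (hX : X ∈ 𝓑) (hB : B ∈ 𝓑)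
    (hd : Disjoint B X) :
    ∑ e ∈ B.powersetCard 2, #{C ∈ 𝓑 | Disjoint C X ∧ e ⊆ C} = 6 := by
  set F : Finset (Finset V) := {C ∈ 𝓑 | Disjoint C X} with hF
  have hmem : ∀ C, C ∈ F ↔ C ∈ 𝓑 ∧ C ⊆ Xᶜ := fun C => by
    rw [hF, mem_filter, subset_compl_iff_disjoint_right]
  have hBX : B ⊆ Xᶜ := subset_compl_iff_disjoint_right.2 hd
  have hinv : ∀ C ∈ F, Xᶜ \ C ∈ F := fun C hC => (hmem _).2
    ⟨h.compl_sdiff_mem H hX ((hmem C).1 hC).1 (mem_filter.1 hC).2, sdiff_subset⟩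
  have hsum : ∑ C ∈ F, (#(B \ C)).choose 2 = ∑ C ∈ F, (#(B ∩ C)).choose 2 := by
    refine sum_nbij' (Xᶜ \ ·) (Xᶜ \ ·) hinv hinv
      (fun C hC => Finset.sdiff_sdiff_eq_self ((hmem C).1 hC).2)
      (fun C hC => Finset.sdiff_sdiff_eq_self ((hmem C).1 hC).2) fun C hC => ?_
    rw [← inter_sdiff_assoc, inter_eq_left.2 hBX]
  have hdisj : ∀ C ∈ F, Disjoint B C ↔ C = Xᶜ \ B := by
    refine fun C hC => ⟨fun hBC => ?_, fun hC => hC ▸ disjoint_sdiff⟩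
    refine eq_of_subset_of_card_le (subset_sdiff.2 ⟨((hmem C).1 hC).2, hBC.symm⟩) ?_
    rw [h.card_compl_sdiff (h.card_block X hX) (h.card_block B hB) hd,
      h.card_block C ((hmem C).1 hC).1]
  have hBF : B ∈ F := (hmem B).2 ⟨hB, hBX⟩
  have hcard := h.card_disjoint_add (h.card_block X hX)
  rw [if_pos hX, ← hF] at hcard
  have h1 := sum_congr (rfl : F = F) fun C hC =>
    (choose_two_card_inter_add_sdiff (h.card_block B hB) (h.card_block C ((hmem C).1 hC).1)).trans
      (by rw [if_congr (hdisj C hC) rfl rfl])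
  rw [sum_add_distrib, hsum, sum_add_distrib, sum_add_distrib, ← mul_sum, ← mul_sum,
    sum_ite_eq', sum_ite_eq', if_pos hBF, if_pos (hinv B hBF), sum_const] at h1
  have h2 := sum_choose_two_card_inter F B
  simp only [hF, filter_filter] at h2
  rw [← h2, sum_congr rfl fun C _ => by rw [inter_comm C B], ← hF]
  simp only [smul_eq_mul] at h1
  omega

theorem false_of_three (h : IsSimpleTripleSystemNine 𝓑 3) (H : HasCommonDisjointBlock 𝓑) :
    False := by
  obtain ⟨X, hX⟩ : 𝓑.Nonempty := by rw [← card_pos, h.card_eq]; norm_num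
  -- Every pair in `Xᶜ` lies in exactly two blocks contained in `Xᶜ`.
  have htwo : ∀ e ∈ Xᶜ.powersetCard 2, #{B ∈ 𝓑 | Disjoint B X ∧ e ⊆ B} = 2 := by
    intro e he
    rw [mem_powersetCard, subset_compl_iff_disjoint_right] at he
    obtain ⟨B, hB, hd, heB⟩ := h.exists_disjoint_of_pair H (by norm_num) hX he.2 he.1
    have hle : ∀ f ∈ B.powersetCard 2, #{C ∈ 𝓑 | Disjoint C X ∧ f ⊆ C} ≤ 2 := fun f hf => by
      rw [mem_powersetCard] at hf
      exact h.card_disjoint_pair_le_two H hX hf.2 (hd.mono_left hf.1)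
    refine (sum_eq_sum_iff_of_le hle).1 ?_ e (mem_powersetCard.2 ⟨heB, he.2⟩)
    rw [h.sum_card_disjoint_pair H hX hB hd]
    simp [h.card_block B hB]
  -- Hence the blocks in `Xᶜ` contain `2 * 15` pairs; but there are eight such blocks.
  have h1 := h.card_disjoint_add (h.card_block X hX)
  have h2 := sum_choose_two_card_inter {B ∈ 𝓑 | Disjoint B X} Xᶜ
  have h3 : ∀ B ∈ ({B ∈ 𝓑 | Disjoint B X} : Finset (Finset V)), (#(B ∩ Xᶜ)).choose 2 = 3 := by
    intro B hB
    rw [mem_filter, ← subset_compl_iff_disjoint_right] at hB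
    rw [inter_eq_left.2 hB.2, h.card_block B hB.1]
    rfl
  simp only [filter_filter] at h2
  rw [sum_congr rfl h3, sum_congr rfl htwo, sum_const, sum_const, card_powersetCard,
    h.card_compl (h.card_block X hX)] at h2
  rw [if_pos hX] at h1
  norm_num [Nat.choose] at h2
  omega

theorem not_hasCommonDisjointBlock (h : IsSimpleTripleSystemNine 𝓑 l) (hl₂ : 2 ≤ l)
    (hl₆ : l ≤ 6) : ¬ HasCommonDisjointBlock 𝓑 := by
  intro H
  have h3 := h.le_three H hl₆
  obtain ⟨X, hX⟩ : 𝓑.Nonempty := by rw [← card_pos, h.card_eq]; omega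
  obtain ⟨p, hp⟩ : Xᶜ.Nonempty := by
    rw [← card_pos, h.card_compl (h.card_block X hX)]
    norm_num
  have h4 := h.two_mul_card_disjoint_mem H hX (mem_compl.1 hp)
  obtain rfl : l = 3 := by omega
  exact h.false_of_three H

end IsSimpleTripleSystemNine

/-! ### Existential closure -/

theorem SimpleGraph.IsExistentiallyClosed.of_succ {W : Type*} [Finite W] {G : SimpleGraph W}
    {n : ℕ} (h : G.IsExistentiallyClosed (n + 1)) : G.IsExistentiallyClosed n := by
  refine ⟨le_trans (by exact_mod_cast n.le_succ) h.1, fun A B hd hn => ?_⟩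
  obtain ⟨w, hw⟩ : ∃ w, w ∉ A ∪ B := by
    by_contra! hc
    have h1 := h.1
    rw [← Set.encard_univ, ← Set.eq_univ_of_forall hc, hn] at h1
    have : n + 1 ≤ n := by exact_mod_cast h1
    omega
  obtain ⟨z, hz, hA, hB⟩ := h.2 (insert w A) B
    (Set.disjoint_insert_left.2 ⟨fun hc => hw (Or.inr hc), hd⟩)
    (by rw [Set.insert_union, Set.encard_insert_of_notMem hw, hn]; rfl)
  refine ⟨z, fun hc => hz ?_, fun a ha => hA a (Set.mem_insert_of_mem w ha), hB⟩
  rw [Set.insert_union]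
  exact Set.mem_insert_of_mem w hc

/-- Existential closure is inherited by smaller orders, so the orders `1` and `2` decide. -/
theorem SimpleGraph.existentialClosureNumber_eq_one {W : Type*} [Finite W] {G : SimpleGraph W}
    (h₁ : G.IsExistentiallyClosed 1) (h₂ : ¬ G.IsExistentiallyClosed 2) :
    G.existentialClosureNumber = 1 := by
  have hlt : ∀ n, 2 ≤ n → ¬ G.IsExistentiallyClosed n := fun n hn => by
    induction n, hn using Nat.le_induction with
    | base => exact h₂
    | succ n _ ih => exact fun h => ih h.of_succ
  refine le_antisymm (csSup_le ⟨1, h₁⟩ fun n hn => ?_)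
    (le_csSup G.bddAbove_isExistentiallyClosed h₁)
  by_contra hc
  exact hlt n (by omega) hn

namespace SetSystem

open Finset

variable {V : Type*} [DecidableEq V] {D : SetSystem V}

/-- In a simple set system, a vertex of the block intersection graph is determined by its
block. -/
theorem IsSimple.toType_ext (hs : D.IsSimple) {x y : D.blocks.ToType} (h : x.1 = y.1) :
    x = y := by
  obtain ⟨X, i⟩ := x
  obtain ⟨Y, j⟩ := y
  obtain rfl : X = Y := h
  have hc := Multiset.nodup_iff_count_le_one.1 hs X
  have hij : i = j := Fin.ext (by omega)
  rw [hij]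

theorem exists_toType {X : Finset V} (hX : X ∈ D.blocks) : ∃ x : D.blocks.ToType, x.1 = X :=
  ⟨⟨X, ⟨0, Multiset.count_pos.2 hX⟩⟩, rfl⟩

theorem not_adj_iff {x y : D.blocks.ToType} (hne : x ≠ y) :
    ¬ D.blockIntersectionGraph.Adj x y ↔ Disjoint x.1 y.1 := by
  rw [disjoint_iff_inter_eq_empty, ← not_nonempty_iff_eq_empty]
  exact not_congr (and_iff_right hne)

theorem hasCommonDisjointBlock (hs : D.IsSimple)
    (h : D.blockIntersectionGraph.IsExistentiallyClosed 2) :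
    IsSimpleTripleSystemNine.HasCommonDisjointBlock ⟨D.blocks, hs⟩ := by
  intro X hX Y hY hXY
  obtain ⟨x, rfl⟩ := exists_toType (D := D) hX
  obtain ⟨y, rfl⟩ := exists_toType (D := D) hY
  have hxy : x ≠ y := fun hc => hXY (hc ▸ rfl)
  obtain ⟨z, hz, -, hB⟩ := h.2 ∅ {x, y} (Set.empty_disjoint _)
    (by rw [Set.empty_union, Set.encard_pair hxy]; rfl)
  simp only [Set.empty_union, Set.mem_insert_iff, Set.mem_singleton_iff, not_or] at hz
  exact ⟨z.1, Multiset.coe_mem, (not_adj_iff hz.1).1 (hB x (by simp)),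
    (not_adj_iff hz.2).1 (hB y (by simp))⟩

variable [Fintype V] {l : ℕ}

theorem IsTripleSystem.isSimpleTripleSystemNine (hD : D.IsTripleSystem 9 l) (hs : D.IsSimple) :
    IsSimpleTripleSystemNine ⟨D.blocks, hs⟩ l where
  card_points := hD.card_points
  card_block := hD.card_block
  card_blocks_containing := hD.card_blocks_containing

/-- A block meets another one, as its pairs lie in at least two blocks each, and is disjoint
from `3l - 1` others. -/
theorem isExistentiallyClosed_one (hl₂ : 2 ≤ l) (hD : D.IsTripleSystem 9 l) (hs : D.IsSimple) :
    D.blockIntersectionGraph.IsExistentiallyClosed 1 := by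
  have h := hD.isSimpleTripleSystemNine hs
  set 𝓑 : Finset (Finset V) := ⟨D.blocks, hs⟩
  have hadj : ∀ x, ∃ z, z ≠ x ∧ D.blockIntersectionGraph.Adj z x := fun x => by
    have hx : x.1 ∈ 𝓑 := Multiset.coe_mem
    obtain ⟨e, hex, he⟩ := exists_subset_card_eq (show 2 ≤ #x.1 by rw [h.card_block _ hx]; norm_num)
    have hlt : 1 < #{B ∈ 𝓑 | e ⊆ B} := by rw [h.card_blocks_containing e he]; omega
    obtain ⟨Z, hZ, hne⟩ := exists_mem_ne hlt x.1
    rw [mem_filter] at hZ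
    obtain ⟨z, rfl⟩ := exists_toType (D := D) hZ.1
    have hzx : z ≠ x := fun hc => hne (hc ▸ rfl)
    refine ⟨z, hzx, hzx, Nonempty.mono (subset_inter hZ.2 hex) ?_⟩
    rw [← card_pos, he]
    norm_num
  have hnot : ∀ x, ∃ z, z ≠ x ∧ ¬ D.blockIntersectionGraph.Adj z x := fun x => by
    have hx : x.1 ∈ 𝓑 := Multiset.coe_mem
    have h1 := h.card_disjoint_add (h.card_block _ hx)
    rw [if_pos hx] at h1
    obtain ⟨Z, hZ⟩ : ({B ∈ 𝓑 | Disjoint B x.1} : Finset (Finset V)).Nonempty := by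
      rw [← card_pos]; omega
    rw [mem_filter] at hZ
    obtain ⟨z, rfl⟩ := exists_toType (D := D) hZ.1
    have hzx : z ≠ x := by
      rintro rfl
      have h3 := h.card_block _ hx
      rw [(disjoint_self_iff_empty _).1 hZ.2] at h3
      simp at h3
    exact ⟨z, hzx, (not_adj_iff hzx).2 hZ.2⟩
  obtain ⟨X, hX⟩ : 𝓑.Nonempty := by rw [← card_pos, h.card_eq]; omega
  obtain ⟨x, -⟩ := exists_toType (D := D) hX
  have : Nonempty D.blocks.ToType := ⟨x⟩
  refine ⟨by simpa using ENat.one_le_card_iff_nonempty _ |>.2 this, fun A B hd hn => ?_⟩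
  obtain ⟨y, hy⟩ := Set.encard_eq_one.1 (by simpa using hn)
  rcases Set.subset_singleton_iff_eq.1 (Set.subset_union_left.trans hy.subset) with rfl | rfl
  · rw [Set.empty_union] at hy
    obtain ⟨z, hz, hadj⟩ := hnot y
    subst hy
    exact ⟨z, by simpa using hz, by simp, by simpa using hadj⟩
  · have hB : B = ∅ := by
      refine Set.subset_empty_iff.1 fun b hb => ?_
      have hby : b ∈ ({y} : Set D.blocks.ToType) := hy ▸ Or.inr hb
      exact Set.disjoint_left.1 hd hby hb
    subst hB
    obtain ⟨z, hz, hadj⟩ := hadj y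
    exact ⟨z, by simpa using hz, by simpa using hadj, by simp⟩

end SetSystem

theorem mainTheorem6 {V : Type*} [Fintype V] [DecidableEq V] (D : SetSystem V) (l : ℕ)
    (hl₂ : 2 ≤ l) (hl₆ : l ≤ 6) (hD : D.IsTripleSystem 9 l) (hs : D.IsSimple) :
    D.blockIntersectionGraph.existentialClosureNumber = 1 :=
  SimpleGraph.existentialClosureNumber_eq_one (SetSystem.isExistentiallyClosed_one hl₂ hD hs)
    fun h => (hD.isSimpleTripleSystemNine hs).not_hasCommonDisjointBlock hl₂ hl₆
      (SetSystem.hasCommonDisjointBlock hs h)
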